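/- **Setting.** Let $\sigma\subseteq\mathbb R$ be measurable (for instance $\mathbb R$, $(\varepsilon_{\min},\infty)$ or $(\varepsilon_{\min},\varepsilon_{\max})$) and let the clock be described by $\mathcal H_C=L^2(\sigma,d\varepsilon)$ with the clock Hamiltonian $\hat H_C$ of multiplication by $\varepsilon$ (non-degenerate, continuous spectrum). For a measurable $g:\mathbb R\to\mathbb R$ let $|t\rangle=\int_\sigma d\varepsilon\,e^{ig(\varepsilon)}e^{-i\varepsilon t}|\varepsilon\rangle$ be the (in general unnormalizable) clock states. Let $\hat H_S$ be a possibly unbounded self-adjoint operator on a complex Hilbert space $\mathcal H_S$. On $\mathcal H_{\rm kin}=\mathcal H_C\otimes\mathcal H_S=L^2(\sigma;\mathcal H_S)$ let $\hat C_H=\hat H_C\otimes I+I\otimes\hat H_S$, i.e. $(\hat C_H\varphi)(\varepsilon)=\varepsilon\varphi(\varepsilon)+\hat H_S\varphi(\varepsilon)$ on its maximal domain, and let $U_{CS}(t)=e^{-it\hat H_C}\otimes e^{-it\hat H_S}$ be the unitary group generated by $\hat C_H$. Let $\hat f_S$ be a closable (possibly unbounded) operator on $\mathcal H_S$ and $\tau\in\mathbb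 R$. The $G$-twirl $$\hat F_{f_S,T}(\tau)=\frac1{2\pi}\int_{\mathbb R}dt\,U_{CS}(t)\,\big(|\tau\rangle\langle\tau|\otimes\hat f_S\big)\,U_{CS}(t)^\dagger$$ is understood weakly: $\hat F_{f_S,T}(\tau)\varphi=\eta$ means that $a_\varphi(t)=(\langle\tau|\otimes I)U_{CS}(t)^\dagger\varphi$ (defined directly for $\varphi\in L^1\cap L^2$, and by $L^2(dt)$-limits for all $\varphi\in\mathcal H_{\rm kin}$) lies in the domain of $\hat f_S$ for almost every $t$, that $t\mapsto\hat f_S a_\varphi(t)$ is square integrable, and that $\langle\psi,\eta\rangle=\frac1{2\pi}\int dt\,\langle a_\psi(t),\hat f_S a_\varphi(t)\rangle$ for all $\psi\in L^1\cap L^2$. **Theorem 1.** This defines a linear operator $\hat F=\hat F_{f_S,T}(\tau)$ on $\mathcal H_{\rm kin}$, which is everywhere defined if $\hat f_S$ is. It is a strong quantum Dirac observable, that is, it commutes with the constraint operator, $[\hat C_H,\hat F]=0$: (i) for every $s\in\mathbb R$, $U_{CS}(s)$ maps the domain of $\hat F$ into itself and $\hat F\,U_{CS}(s)\varphi=U_{CS}(s)\hat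 F\varphi$ for all $\varphi$ in the domain of $\hat F$; (ii) if $\varphi$ is in the domains of $\hat C_H$ and $\hat F$, and $\hat C_H\varphi$ is in the domain of $\hat F$, then $\hat F\varphi$ is in the domain of $\hat C_H$ and $\hat C_H\hat F\varphi=\hat F\hat C_H\varphi$. -/

import Mathlib

open MeasureTheory Filter Topology Complex

noncomputable section

namespace RelationalDirac

/-- `U t = exp (-i t A)`: the strongly continuous one-parameter unitary group `U` is generated by
the (possibly unbounded) operator `A`, i.e. `x ∈ D(A)` with `A x = y` exactly when `t ↦ U t x` is
differentiable at `0` with derivative `-i y`. For self-adjoint `A` there is exactly one such `U`. -/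
structure IsUnitaryGroupOf {H : Type*} [NormedAddCommGroup H] [InnerProductSpace ℂ H]
    [CompleteSpace H] (A : H →ₗ.[ℂ] H) (U : ℝ → H →L[ℂ] H) : Prop where
  unitary_mem : ∀ t, U t ∈ unitary (H →L[ℂ] H)
  map_zero : U 0 = 1
  map_add : ∀ s t, U (s + t) = U s * U t
  continuous_apply : ∀ x, Continuous fun t => U t x
  mem_graph_iff : ∀ x y, (x, y) ∈ A.graph ↔ HasDerivAt (fun t => U t x) (-(I • y)) 0

section Kinematics

variable {K : Type*} [NormedAddCommGroup K] [InnerProductSpace ℂ K]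

/-- The kinematical Hilbert space `L²(σ, dε) ⊗ K = L²(σ, dε; K)`: the clock Hilbert space is
`L²(σ, dε)` in the energy representation (so that the clock Hamiltonian is multiplication by `ε`,
a non-degenerate operator with continuous spectrum), and `K` is the Hilbert space of the system. -/
abbrev Kin (σ : Set ℝ) (K : Type*) [NormedAddCommGroup K] : Type _ :=
  Lp K 2 (volume.restrict σ)

/-- The graph of the constraint operator `H_C ⊗ I + I ⊗ H_S`: `φ` is sent to
`ε ↦ ε φ(ε) + H_S φ(ε)`, on all `φ` for which this makes sense and is square integrable. -/
def constraintGraph (σ : Set ℝ) (HS : K →ₗ.[ℂ] K) : Submodule ℂ (Kin σ K × Kin σ K) where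
  carrier := {p | ∀ᵐ ε ∂(volume.restrict σ), (p.1 ε, p.2 ε - (ε : ℂ) • p.1 ε) ∈ HS.graph}
  zero_mem' := by
    filter_upwards [Lp.coeFn_zero K 2 (volume.restrict σ)] with ε h
    simp only [Prod.fst_zero, Prod.snd_zero, h, Pi.zero_apply, smul_zero, sub_zero]
    exact HS.graph.zero_mem
  add_mem' := by
    rintro ⟨a, b⟩ ⟨c, d⟩ h1 h2
    filter_upwards [h1, h2, Lp.coeFn_add a c, Lp.coeFn_add b d] with ε h1 h2 h3 h4
    have h := HS.graph.add_mem h1 h2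
    simp only [Prod.mk_add_mk, h3, h4, Pi.add_apply, smul_add] at h ⊢
    convert h using 2
    abel
  smul_mem' := by
    rintro z ⟨a, b⟩ h1
    filter_upwards [h1, Lp.coeFn_smul z a, Lp.coeFn_smul z b] with ε h1 h3 h4
    have h := HS.graph.smul_mem z h1
    simp only [Prod.smul_mk, h3, h4, Pi.smul_apply, smul_sub] at h ⊢
    rwa [smul_comm]

/-- The constraint operator `C_H = H_C ⊗ I + I ⊗ H_S`. -/
def constraint (σ : Set ℝ) (HS : K →ₗ.[ℂ] K) : Kin σ K →ₗ.[ℂ] Kin σ K :=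
  (constraintGraph σ HS).toLinearPMap

theorem constraint_graph (σ : Set ℝ) (HS : K →ₗ.[ℂ] K) :
    (constraint σ HS).graph = constraintGraph σ HS := by
  refine Submodule.toLinearPMap_graph_eq _ ?_
  rintro ⟨a, b⟩ h h0
  simp only at h0
  subst h0
  apply Lp.ext
  have h : ∀ᵐ ε ∂(volume.restrict σ), ((0 : Kin σ K) ε, b ε - (ε : ℂ) • (0 : Kin σ K) ε)
    ∈ HS.graph := h
  filter_upwards [h, Lp.coeFn_zero K 2 (volume.restrict σ)] with ε h h1
  simp only [h1, Pi.zero_apply, smul_zero, sub_zero] at h ⊢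
  exact HS.graph_fst_eq_zero_snd h rfl

theorem memLp_UCS (σ : Set ℝ) (US : ℝ → K →L[ℂ] K) (t : ℝ) (φ : Kin σ K) :
    MemLp (fun ε : ℝ => cexp (-(I * ε * t)) • US t (φ ε)) 2 (volume.restrict σ) := by
  have h : MemLp (fun ε => US t (φ ε)) 2 (volume.restrict σ) :=
    (US t).comp_memLp' (Lp.memLp φ)
  refine h.of_le ?_ ?_
  · exact (Continuous.aestronglyMeasurable (by fun_prop)).smul h.1
  · refine Eventually.of_forall fun ε => ?_
    rw [norm_smul, Complex.norm_exp]
    simp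

/-- The unitary `U_CS(t) = exp (-i t C_H) = exp (-i t H_C) ⊗ exp (-i t H_S)`, where
`US t = exp (-i t H_S)`. Its adjoint is `U_CS(-t)`. -/
def UCS (σ : Set ℝ) (US : ℝ → K →L[ℂ] K) (t : ℝ) (φ : Kin σ K) : Kin σ K :=
  (memLp_UCS σ US t φ).toLp _

/-- The clock state `|t⟩ = ∫_σ dε exp (i g(ε)) exp (-i ε t) |ε⟩`, as a function of the energy. -/
def clockState (g : ℝ → ℝ) (t ε : ℝ) : ℂ := cexp (I * g ε) * cexp (-(I * ε * t))

/-- `(⟨t| ⊗ I) φ`, a vector of the system, for states `φ` that are integrable over the energy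
(the states on which the unnormalizable `|t⟩` acts directly). -/
def clockBra (σ : Set ℝ) (g : ℝ → ℝ) (t : ℝ) (φ : Kin σ K) : K :=
  ∫ ε in σ, star (clockState g t ε) • φ ε

/-- `t ↦ (⟨τ| ⊗ I) U_CS(t)† φ` for states `φ` that are integrable over the energy. -/
def amplitude (σ : Set ℝ) (g : ℝ → ℝ) (US : ℝ → K →L[ℂ] K) (τ : ℝ) (φ : Kin σ K) (t : ℝ) : K :=
  clockBra σ g τ (UCS σ US (-t) φ)

/-- `a(t) = (⟨τ| ⊗ I) U_CS(t)† φ` for almost every `t`, for an arbitrary state `φ`: as always with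
unnormalizable states, this is the square-integrable limit of the amplitudes of integrable states
tending to `φ`. -/
def IsAmplitude (σ : Set ℝ) (g : ℝ → ℝ) (US : ℝ → K →L[ℂ] K) (τ : ℝ) (φ : Kin σ K)
    (a : ℝ → K) : Prop :=
  MemLp a 2 volume ∧ ∃ u : ℕ → Kin σ K,
    (∀ n, Integrable (u n) (volume.restrict σ) ∧ MemLp (amplitude σ g US τ (u n)) 2 volume) ∧
    Tendsto u atTop (𝓝 φ) ∧
    Tendsto (fun n => eLpNorm (amplitude σ g US τ (u n) - a) 2 volume) atTop (𝓝 0)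

/-- `η = F φ` for the `G`-twirl `F = (1 / 2π) ∫ dt U_CS(t) (|τ⟩⟨τ| ⊗ f) U_CS(t)†`, an integral in
the weak sense: for every state `ψ` that is integrable over the energy,
`⟨ψ, η⟩ = (1 / 2π) ∫ dt ⟨(⟨τ| ⊗ I) U_CS(t)† ψ, f (⟨τ| ⊗ I) U_CS(t)† φ⟩`.
If `f` is unbounded, then `(⟨τ| ⊗ I) U_CS(t)† φ` has to lie in the domain of `f` for almost
every `t`, with a square-integrable image `b(t)`. -/
def IsTwirl (σ : Set ℝ) (g : ℝ → ℝ) (US : ℝ → K →L[ℂ] K) (f : K →ₗ.[ℂ] K) (τ : ℝ)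
    (φ η : Kin σ K) : Prop :=
  ∃ a b : ℝ → K, IsAmplitude σ g US τ φ a ∧ MemLp b 2 volume ∧
    (∀ᵐ t, (a t, b t) ∈ f.graph) ∧
    ∀ ψ : Kin σ K, Integrable ψ (volume.restrict σ) →
      Integrable (fun t => inner ℂ (amplitude σ g US τ ψ t) (b t)) volume ∧
      inner ℂ ψ η = (1 / (2 * Real.pi) : ℂ) * ∫ t, inner ℂ (amplitude σ g US τ ψ t) (b t)

section Linearity

variable {σ : Set ℝ} {g : ℝ → ℝ} {US : ℝ → K →L[ℂ] K} {f : K →ₗ.[ℂ] K} {τ : ℝ}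

theorem UCS_coe (t : ℝ) (φ : Kin σ K) : UCS σ US t φ =ᵐ[volume.restrict σ]
    fun ε : ℝ => cexp (-(I * ε * t)) • US t (φ ε) :=
  MemLp.coeFn_toLp _

theorem UCS_add (t : ℝ) (φ ψ : Kin σ K) : UCS σ US t (φ + ψ) = UCS σ US t φ + UCS σ US t ψ := by
  apply Lp.ext
  filter_upwards [UCS_coe (US := US) t (φ + ψ), UCS_coe (US := US) t φ, UCS_coe (US := US) t ψ,
    Lp.coeFn_add φ ψ, Lp.coeFn_add (UCS σ US t φ) (UCS σ US t ψ)] with ε h1 h2 h3 h4 h5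
  simp only [h1, h5, Pi.add_apply, h2, h3, h4, map_add, smul_add]

theorem UCS_smul (t : ℝ) (z : ℂ) (φ : Kin σ K) : UCS σ US t (z • φ) = z • UCS σ US t φ := by
  apply Lp.ext
  filter_upwards [UCS_coe (US := US) t (z • φ), UCS_coe (US := US) t φ,
    Lp.coeFn_smul z φ, Lp.coeFn_smul z (UCS σ US t φ)] with ε h1 h2 h4 h5
  simp only [h1, h5, Pi.smul_apply, h2, h4, map_smul]
  rw [smul_comm]

theorem norm_clockState (t ε : ℝ) : ‖clockState g t ε‖ = 1 := by
  simp [clockState, Complex.norm_exp]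

theorem integrable_bra (hg : Measurable g) (t : ℝ) {φ : Kin σ K}
    (h : Integrable φ (volume.restrict σ)) :
    Integrable (fun ε => star (clockState g t ε) • φ ε) (volume.restrict σ) := by
  have hm : Measurable fun ε => star (clockState g t ε) := by
    unfold clockState
    fun_prop
  refine h.mono (hm.aestronglyMeasurable.smul h.1) (Eventually.of_forall fun ε => ?_)
  rw [norm_smul, norm_star, norm_clockState, one_mul]

theorem integrable_UCS (t : ℝ) {φ : Kin σ K} (h : Integrable φ (volume.restrict σ)) :
    Integrable (UCS σ US t φ) (volume.restrict σ) := by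
  refine Integrable.congr ?_ (UCS_coe (US := US) t φ).symm
  have h' := (US t).integrable_comp h
  refine h'.mono ?_ (Eventually.of_forall fun ε => ?_)
  · exact (Continuous.aestronglyMeasurable (by fun_prop)).smul h'.1
  · rw [norm_smul, Complex.norm_exp]
    simp

theorem amplitude_add (hg : Measurable g) {φ ψ : Kin σ K}
    (h : Integrable φ (volume.restrict σ)) (h' : Integrable ψ (volume.restrict σ)) :
    amplitude σ g US τ (φ + ψ) = amplitude σ g US τ φ + amplitude σ g US τ ψ := by
  funext t
  simp only [amplitude, Pi.add_apply, clockBra]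
  rw [UCS_add, ← integral_add (integrable_bra hg τ (integrable_UCS (-t) h))
    (integrable_bra hg τ (integrable_UCS (-t) h'))]
  refine integral_congr_ae ?_
  filter_upwards [Lp.coeFn_add (UCS σ US (-t) φ) (UCS σ US (-t) ψ)] with ε h1
  simp only [h1, Pi.add_apply, smul_add]

theorem amplitude_smul (z : ℂ) (φ : Kin σ K) :
    amplitude σ g US τ (z • φ) = z • amplitude σ g US τ φ := by
  funext t
  simp only [amplitude, Pi.smul_apply, clockBra]
  rw [UCS_smul, ← integral_smul]
  refine integral_congr_ae ?_
  filter_upwards [Lp.coeFn_smul z (UCS σ US (-t) φ)] with ε h1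
  simp only [h1, Pi.smul_apply]
  rw [smul_comm]

theorem amplitude_zero : amplitude σ g US τ (0 : Kin σ K) = 0 := by
  simpa using amplitude_smul (g := g) (US := US) (τ := τ) (0 : ℂ) (0 : Kin σ K)

theorem IsAmplitude.zero : IsAmplitude σ g US τ (0 : Kin σ K) 0 := by
  refine ⟨MemLp.zero, fun _ => 0, fun _ => ⟨?_, ?_⟩, tendsto_const_nhds, ?_⟩
  · exact (integrable_zero ℝ K _).congr (Lp.coeFn_zero K 2 (volume.restrict σ)).symm
  · rw [amplitude_zero]
    exact MemLp.zero
  · simp [amplitude_zero]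

theorem IsAmplitude.add (hg : Measurable g) {φ ψ : Kin σ K} {a b : ℝ → K}
    (ha : IsAmplitude σ g US τ φ a) (hb : IsAmplitude σ g US τ ψ b) :
    IsAmplitude σ g US τ (φ + ψ) (a + b) := by
  obtain ⟨ha, u, hu, hu1, hu2⟩ := ha
  obtain ⟨hb, v, hv, hv1, hv2⟩ := hb
  have key : ∀ n, amplitude σ g US τ (u n + v n)
      = amplitude σ g US τ (u n) + amplitude σ g US τ (v n) :=
    fun n => amplitude_add hg (hu n).1 (hv n).1
  refine ⟨ha.add hb, fun n => u n + v n, fun n => ⟨?_, ?_⟩, hu1.add hv1, ?_⟩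
  · exact ((hu n).1.add (hv n).1).congr (Lp.coeFn_add (u n) (v n)).symm
  · rw [key]
    exact (hu n).2.add (hv n).2
  · have h0 := hu2.add hv2
    rw [add_zero] at h0
    refine tendsto_of_tendsto_of_tendsto_of_le_of_le tendsto_const_nhds h0 (fun _ => zero_le)
      fun n => ?_
    have h1 := eLpNorm_add_le ((hu n).2.sub ha).1 ((hv n).2.sub hb).1 (p := 2) (by norm_num)
    simp only [key]
    rwa [add_sub_add_comm]

theorem IsAmplitude.smul (z : ℂ) {φ : Kin σ K} {a : ℝ → K} (ha : IsAmplitude σ g US τ φ a) :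
    IsAmplitude σ g US τ (z • φ) (z • a) := by
  obtain ⟨ha, u, hu, hu1, hu2⟩ := ha
  refine ⟨ha.const_smul z, fun n => z • u n, fun n => ⟨?_, ?_⟩, hu1.const_smul z, ?_⟩
  · exact ((hu n).1.smul z).congr (Lp.coeFn_smul z (u n)).symm
  · rw [amplitude_smul]
    exact (hu n).2.const_smul z
  · simp only [amplitude_smul, ← smul_sub, eLpNorm_const_smul]
    have h := ENNReal.Tendsto.const_mul (a := ‖z‖ₑ) hu2 (Or.inr enorm_ne_top)
    simpa using h

end Linearity

/-- The graph of the `G`-twirl. -/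
def gTwirlGraph (σ : Set ℝ) {g : ℝ → ℝ} (hg : Measurable g) (US : ℝ → K →L[ℂ] K)
    (f : K →ₗ.[ℂ] K) (τ : ℝ) : Submodule ℂ (Kin σ K × Kin σ K) where
  carrier := {p | IsTwirl σ g US f τ p.1 p.2}
  zero_mem' := by
    refine ⟨0, 0, IsAmplitude.zero, MemLp.zero, Eventually.of_forall fun t => f.graph.zero_mem,
      fun ψ _ => ?_⟩
    simp
  add_mem' := by
    rintro ⟨φ, η⟩ ⟨φ', η'⟩ ⟨a, b, h1, h2, h3, h4⟩ ⟨a', b', h1', h2', h3', h4'⟩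
    refine ⟨a + a', b + b', h1.add hg h1', h2.add h2', ?_, fun ψ hψ => ?_⟩
    · filter_upwards [h3, h3'] with t h h'
      exact f.graph.add_mem h h'
    · obtain ⟨h5, h6⟩ := h4 ψ hψ
      obtain ⟨h5', h6'⟩ := h4' ψ hψ
      simp only [Pi.add_apply, inner_add_right]
      refine ⟨h5.add h5', ?_⟩
      rw [integral_add h5 h5', mul_add, ← h6, ← h6']
      exact inner_add_right _ _ _
  smul_mem' := by
    rintro z ⟨φ, η⟩ ⟨a, b, h1, h2, h3, h4⟩
    refine ⟨z • a, z • b, h1.smul z, h2.const_smul z, ?_, fun ψ hψ => ?_⟩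
    · filter_upwards [h3] with t h
      exact f.graph.smul_mem z h
    · obtain ⟨h5, h6⟩ := h4 ψ hψ
      simp only [Pi.smul_apply, inner_smul_right]
      refine ⟨h5.const_mul z, ?_⟩
      rw [integral_const_mul, mul_left_comm, ← h6]
      exact inner_smul_right _ _ _

/-- The relational observable `F(τ) = (1 / 2π) ∫ dt U_CS(t) (|τ⟩⟨τ| ⊗ f) U_CS(t)†`, the `G`-twirl
of `|τ⟩⟨τ| ⊗ f`, as an operator on the kinematical Hilbert space. -/
def gTwirl (σ : Set ℝ) {g : ℝ → ℝ} (hg : Measurable g) (US : ℝ → K →L[ℂ] K)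
    (f : K →ₗ.[ℂ] K) (τ : ℝ) : Kin σ K →ₗ.[ℂ] Kin σ K :=
  (gTwirlGraph σ hg US f τ).toLinearPMap

end Kinematics

end RelationalDirac

/-! Write A for the map φ ↦ a_φ. On integrable states it is multiplication by the phase exp(-ig),
extension by zero to ℝ, Fourier transform, the substitution of frequency -(t+τ)/2π, and the
pointwise unitary exp(itH_S). By Plancherel each factor is bounded on L², so A extends to a bounded
operator `amplitudeL` from the kinematical space to L²(ℝ;K), and the limits defining a_φ are exactly
its values (`isAmplitude_iff`). Hence F = (1/2π) A* f̂ A, where f̂ is f applied pointwise in t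
(`isTwirl_iff`). Such an f̂ is single-valued, so F is an operator; an everywhere defined closable f
is bounded by the closed graph theorem, so F is then everywhere defined.

A turns U_CS(s) into translation by -s (`amplitudeL_UCS`), f̂ commutes with translations, and A*
turns them back into U_CS(s). This is (i).

For (ii), the domain of the constraint has to be reached from (i) although f is unbounded. If Cφ =
χ, then t ↦ T_t Aφ has derivative iAχ at 0, with T_t translation by t. Put b = f̂Aφ and b' = f̂Aχ.
The lift of the closure of f is closed, so it may be applied under the integral of the derivative,
which gives T_s b - b = ∫₀ˢ T_t(ib') dt. So T_t b is differentiable, and applying A* shows that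
U_CS(t)Fφ is differentiable at 0 with derivative -iFχ. Since C contains every such derivative pair
of U_CS (`mem_constraintGraph_of_hasDerivAt`, where self-adjointness of H_S enters), CFφ = FCφ. -/

namespace RelationalDirac

/-! ### The Fourier transform on L¹ ∩ L². -/

section Fourier

open FourierTransform

variable {K : Type*} [NormedAddCommGroup K] [InnerProductSpace ℂ K] [CompleteSpace K]

/-- On `L¹ ∩ L²` the Fourier transform of `L²` is given by the Fourier integral. -/
theorem fourier_toLp_ae {h : ℝ → K} (h1 : Integrable h) (h2 : MemLp h 2 volume) :
    (𝓕 (h2.toLp h) : Lp K 2 (volume : Measure ℝ)) =ᵐ[volume] 𝓕 h := by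
  have hc : Continuous (𝓕 h) :=
    VectorFourier.fourierIntegral_continuous Real.continuous_fourierChar
      (by exact continuous_inner) h1
  refine ae_eq_of_integral_contDiff_smul_eq
    ((Lp.memLp _).locallyIntegrable (by norm_num)) hc.locallyIntegrable fun ψ hψ hψc => ?_
  have hs : HasCompactSupport (Complex.ofRealCLM ∘ ψ) := hψc.comp_left rfl
  have hd : ContDiff ℝ (⊤ : ℕ∞) (Complex.ofRealCLM ∘ ψ) := Complex.ofRealCLM.contDiff.comp hψ
  set Ψ : SchwartzMap ℝ ℂ := hs.toSchwartzMap hd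
  have hΨ : ∀ x, Ψ x = (ψ x : ℂ) := fun x => rfl
  -- The L² transform is also the distributional one, so against a test function it can be moved
  -- onto the test function; Fubini for two integrable functions moves it back onto `h`.
  have key := congrArg (fun D => D Ψ)
    (Lp.fourier_toTemperedDistribution_eq (h2.toLp h))
  simp only [TemperedDistribution.fourier_apply, Lp.toTemperedDistribution_apply, hΨ,
    Complex.coe_smul] at key
  rw [← key]
  have e : ∫ x, (𝓕 Ψ) x • (h2.toLp h) x = ∫ x, (𝓕 (Ψ : ℝ → ℂ)) x • h x := by
    refine integral_congr_ae ?_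
    filter_upwards [h2.coeFn_toLp] with x hx
    rw [hx, SchwartzMap.fourier_coe]
  rw [e]
  have := VectorFourier.integral_fourierIntegral_smul_eq_flip (L := innerₗ ℝ)
    Real.continuous_fourierChar continuous_inner (Ψ.integrable (μ := (volume : Measure ℝ))) h1
  rw [flip_innerₗ] at this
  exact this
end Fourier

/-! ### One-parameter unitary groups. -/

section UnitaryGroup

variable {H : Type*} [NormedAddCommGroup H] [InnerProductSpace ℂ H] [CompleteSpace H]
  {A : H →ₗ.[ℂ] H} {U : ℝ → H →L[ℂ] H}

theorem IsUnitaryGroupOf.norm_map (hU : IsUnitaryGroupOf A U) (t : ℝ) (x : H) : ‖U t x‖ = ‖x‖ :=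
  Unitary.norm_map ⟨U t, hU.unitary_mem t⟩ x

theorem IsUnitaryGroupOf.add_apply (hU : IsUnitaryGroupOf A U) (s t : ℝ) (x : H) :
    U (s + t) x = U s (U t x) := by
  rw [hU.map_add]
  rfl

theorem IsUnitaryGroupOf.neg_apply_self (hU : IsUnitaryGroupOf A U) (t : ℝ) (x : H) :
    U (-t) (U t x) = x := by
  rw [← hU.add_apply, neg_add_cancel, hU.map_zero]
  rfl

theorem IsUnitaryGroupOf.inner_apply_left (hU : IsUnitaryGroupOf A U) (t : ℝ) (x y : H) :
    inner ℂ (U t x) y = inner ℂ x (U (-t) y) := by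
  have h := (LinearMap.norm_map_iff_inner_map_map (U t)).1 (hU.norm_map t) x (U (-t) y)
  rw [← h]
  have h' := hU.neg_apply_self (-t) y
  rw [neg_neg] at h'
  rw [h']

/-- Strong continuity and the uniform Lipschitz constant 1 give joint continuity, which makes t ↦
exp(itH_S) b(t) measurable for measurable b. -/
theorem IsUnitaryGroupOf.continuous_uncurry (hU : IsUnitaryGroupOf A U) :
    Continuous fun p : ℝ × H => U p.1 p.2 := by
  refine continuous_prod_of_continuous_lipschitzWith' _ 1 (fun t => ?_) hU.continuous_apply
  exact LipschitzWith.of_dist_le_mul fun x y => by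
    simp [dist_eq_norm, ← map_sub, hU.norm_map]

end UnitaryGroup

/-! ### The amplitude map as a bounded operator. -/

section Amplitude

open FourierTransform

variable {K : Type*} [NormedAddCommGroup K] [InnerProductSpace ℂ K]
  {σ : Set ℝ} {g : ℝ → ℝ} {US : ℝ → K →L[ℂ] K} {HS : K →ₗ.[ℂ] K} {f : K →ₗ.[ℂ] K} {τ : ℝ}

omit [InnerProductSpace ℂ K] in
theorem indicator_ae_eq_indicator (hσ : MeasurableSet σ) {u v : ℝ → K}
    (h : ∀ᵐ ε ∂(volume.restrict σ), u ε = v ε) : σ.indicator u =ᵐ[volume] σ.indicator v := by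
  filter_upwards [(ae_restrict_iff' hσ).1 h] with ε h
  by_cases hε : ε ∈ σ
  · simp [hε, h hε]
  · simp [hε]

theorem memLp_phase_extend (hσ : MeasurableSet σ) (hg : Measurable g) (φ : Kin σ K) :
    MemLp (σ.indicator fun ε => cexp (-(I * g ε)) • φ ε) 2 volume := by
  rw [memLp_indicator_iff_restrict hσ]
  refine (Lp.memLp φ).of_le ?_ (Eventually.of_forall fun ε => ?_)
  · have hm : Measurable fun ε => cexp (-(I * g ε)) := by fun_prop
    exact hm.aestronglyMeasurable.smul (Lp.memLp φ).1
  · rw [norm_smul, Complex.norm_exp]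
    simp

/-- Multiplication by the phase `exp (-i g)`, followed by extension by zero from `σ` to `ℝ`. -/
def phaseExtend (hσ : MeasurableSet σ) (hg : Measurable g) :
    Kin σ K →L[ℂ] Lp K 2 (volume : Measure ℝ) :=
  LinearMap.mkContinuous
    { toFun := fun φ => (memLp_phase_extend hσ hg φ).toLp
      map_add' := fun φ ψ => by
        rw [← MemLp.toLp_add, MemLp.toLp_eq_toLp_iff, ← Set.indicator_add']
        refine indicator_ae_eq_indicator hσ ?_
        filter_upwards [Lp.coeFn_add φ ψ] with ε h
        rw [h]
        exact smul_add _ _ _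
      map_smul' := fun z φ => by
        rw [RingHom.id_apply, ← MemLp.toLp_const_smul, MemLp.toLp_eq_toLp_iff,
          show z • σ.indicator (fun ε => cexp (-(I * g ε)) • φ ε) =
            σ.indicator (z • fun ε => cexp (-(I * g ε)) • φ ε) from
            (Set.indicator_const_smul σ z _).symm]
        refine indicator_ae_eq_indicator hσ ?_
        filter_upwards [Lp.coeFn_smul z φ] with ε h
        rw [h]
        exact smul_comm _ _ _ }
    1 fun φ => by
      simp only [LinearMap.coe_mk, AddHom.coe_mk, one_mul, Lp.norm_toLp]
      rw [Lp.norm_def, eLpNorm_indicator_eq_eLpNorm_restrict hσ]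
      refine (ENNReal.toReal_mono (Lp.eLpNorm_ne_top φ) (eLpNorm_mono fun ε => ?_))
      rw [norm_smul, Complex.norm_exp]
      simp

/-- With the Fourier kernel exp(-2πiεω), the frequency ω = -(t+τ)/2π produces exp(iε(t+τ)); the
Jacobian accounts for the factor 2π. -/
theorem measurePreserving_frequency (τ : ℝ) :
    MeasurePreserving (fun t : ℝ => -(2 * Real.pi)⁻¹ * (t + τ)) volume
      (ENNReal.ofReal (2 * Real.pi) • volume) := by
  have h : MeasurePreserving (fun t : ℝ => -(2 * Real.pi)⁻¹ * t) volume
      (ENNReal.ofReal (2 * Real.pi) • volume) := by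
    refine ⟨by fun_prop, ?_⟩
    rw [Real.map_volume_mul_left (by simp [Real.pi_ne_zero])]
    congr 2
    rw [inv_neg, inv_inv, abs_neg, abs_of_pos Real.two_pi_pos]
  exact h.comp (measurePreserving_add_right volume τ)

omit [InnerProductSpace ℂ K] in
theorem dense_integrable : Dense {φ : Kin σ K | Integrable φ (volume.restrict σ)} := by
  refine (Lp.simpleFunc.denseRange (E := K) (p := 2) (μ := volume.restrict σ)
    (by norm_num)).mono ?_
  rintro _ ⟨s, rfl⟩
  have h := (SimpleFunc.memLp_iff_integrable (by norm_num) (by norm_num)).1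
    (Lp.simpleFunc.memLp s)
  exact h.congr (Lp.simpleFunc.toSimpleFunc_eq_toFun s)

variable [CompleteSpace K]

theorem memLp_backward (hUS : IsUnitaryGroupOf HS US) (τ : ℝ)
    (b : Lp K 2 (volume : Measure ℝ)) :
    MemLp (fun t : ℝ => US (-t) (b (-(2 * Real.pi)⁻¹ * (t + τ)))) 2 volume := by
  have h : MemLp (b ∘ fun t : ℝ => -(2 * Real.pi)⁻¹ * (t + τ)) 2 volume :=
    ((Lp.memLp b).smul_measure ENNReal.ofReal_ne_top).comp_measurePreserving (measurePreserving_frequency τ)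
  refine h.of_le ?_ (Eventually.of_forall fun t => (hUS.norm_map _ _).le)
  exact hUS.continuous_uncurry.comp_aestronglyMeasurable
    (continuous_neg.aestronglyMeasurable.prodMk h.1)

theorem ae_frequency {p : ℝ → Prop} (h : ∀ᵐ w, p w) (τ : ℝ) :
    ∀ᵐ t : ℝ, p (-(2 * Real.pi)⁻¹ * (t + τ)) :=
  (measurePreserving_frequency τ).quasiMeasurePreserving.ae (Measure.ae_smul_measure h _)

/-- `b ↦ (t ↦ exp (i t H_S) b (-(t + τ) / 2π))`. -/
def backward (hUS : IsUnitaryGroupOf HS US) (τ : ℝ) :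
    Lp K 2 (volume : Measure ℝ) →L[ℂ] Lp K 2 (volume : Measure ℝ) :=
  LinearMap.mkContinuous
    { toFun := fun b => (memLp_backward hUS τ b).toLp
      map_add' := fun a b => by
        rw [← MemLp.toLp_add, MemLp.toLp_eq_toLp_iff]
        filter_upwards [ae_frequency (Lp.coeFn_add a b) τ] with t h
        rw [h]
        exact map_add (US (-t)) _ _
      map_smul' := fun z b => by
        rw [RingHom.id_apply, ← MemLp.toLp_const_smul, MemLp.toLp_eq_toLp_iff]
        filter_upwards [ae_frequency (Lp.coeFn_smul z b) τ] with t h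
        rw [h]
        exact map_smul (US (-t)) z _ }
    -- The bound √(2π) is the L² effect of the change of variables; exp(itH_S) preserves norms.
    (ENNReal.ofReal (2 * Real.pi) ^ (1 / (2 : ENNReal)).toReal).toReal fun b => by
      simp only [LinearMap.coe_mk, AddHom.coe_mk, Lp.norm_toLp]
      rw [Lp.norm_def, ← ENNReal.toReal_mul]
      refine ENNReal.toReal_mono (ENNReal.mul_ne_top
        (ENNReal.rpow_ne_top_of_nonneg ENNReal.toReal_nonneg ENNReal.ofReal_ne_top) (Lp.eLpNorm_ne_top b)) ?_
      rw [← smul_eq_mul (_ ^ _), ← eLpNorm_smul_measure_of_ne_top (by simp),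
        ← eLpNorm_comp_measurePreserving ((Lp.memLp b).smul_measure ENNReal.ofReal_ne_top).1
          (measurePreserving_frequency τ)]
      exact eLpNorm_mono fun t => (hUS.norm_map _ _).le

/-- The continuous extension of `φ ↦ (t ↦ (⟨τ| ⊗ I) U_CS(t)† φ)` to all states. -/
def amplitudeL (hσ : MeasurableSet σ) (hg : Measurable g) (hUS : IsUnitaryGroupOf HS US) (τ : ℝ) :
    Kin σ K →L[ℂ] Lp K 2 (volume : Measure ℝ) :=
  backward hUS τ ∘L (Lp.fourierTransformₗᵢ ℝ K).toLinearIsometry.toContinuousLinearMap ∘L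
    phaseExtend hσ hg

theorem amplitudeL_ae (hσ : MeasurableSet σ) (hg : Measurable g) (hUS : IsUnitaryGroupOf HS US)
    {φ : Kin σ K} (hφ : Integrable φ (volume.restrict σ)) :
    amplitudeL hσ hg hUS τ φ =ᵐ[volume] amplitude σ g US τ φ := by
  have hi : Integrable (σ.indicator fun ε => cexp (-(I * g ε)) • φ ε) := by
    rw [integrable_indicator_iff hσ]
    refine Integrable.mono hφ ?_ (Eventually.of_forall fun ε => ?_)
    · have hm : Measurable fun ε => cexp (-(I * g ε)) := by fun_prop
      exact hm.aestronglyMeasurable.smul hφ.1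
    · rw [norm_smul, Complex.norm_exp]
      simp
  have h1 := ae_frequency (fourier_toLp_ae hi (memLp_phase_extend hσ hg φ)) τ
  filter_upwards [h1, (memLp_backward hUS τ
    (𝓕 ((memLp_phase_extend hσ hg φ).toLp) : Lp K 2 (volume : Measure ℝ))).coeFn_toLp]
    with t h1 h2
  refine h2.trans ?_
  rw [h1, Real.fourier_eq', amplitude, clockBra]
  -- In exp(iε(t+τ)) the part with t comes from the clock factor of U_CS(t)†, the part with τ from
  -- ⟨τ|.
  have e : ∀ v : ℝ, cexp (↑(-2 * Real.pi * inner ℝ v (-(2 * Real.pi)⁻¹ * (t + τ))) * I) •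
      σ.indicator (fun ε => cexp (-(I * g ε)) • φ ε) v = σ.indicator (fun ε : ℝ =>
        cexp (I * ε * (t + τ)) • cexp (-(I * g ε)) • φ ε) v := by
    intro v
    by_cases hv : v ∈ σ
    · simp only [Set.indicator_of_mem hv]
      congr 2
      have : (Real.pi : ℂ) ≠ 0 := by exact_mod_cast Real.pi_ne_zero
      simp only [RCLike.inner_apply, conj_trivial]
      push_cast
      field_simp
    · simp [Set.indicator_of_notMem hv]
  simp only [e]
  rw [integral_indicator hσ, ← ContinuousLinearMap.integral_comp_comm]
  · refine integral_congr_ae ?_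
    filter_upwards [UCS_coe (US := US) (-t) φ] with ε h
    rw [h, clockState]
    simp only [map_smul, smul_smul, ← Complex.exp_add, RCLike.star_def, ← Complex.exp_conj]
    congr 2
    simp only [map_add, map_neg, map_mul, conj_I, conj_ofReal]
    push_cast
    ring
  · refine Integrable.mono hφ ?_ (Eventually.of_forall fun ε => ?_)
    · have hm : Measurable fun ε : ℝ => cexp (I * ε * (t + τ)) := by fun_prop
      have hm' : Measurable fun ε => cexp (-(I * g ε)) := by fun_prop
      exact hm.aestronglyMeasurable.smul (hm'.aestronglyMeasurable.smul hφ.1)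
    · rw [norm_smul, norm_smul, Complex.norm_exp, Complex.norm_exp]
      simp

/-- Continuity of `amplitudeL` makes the limit independent of the approximating sequence, and
density of the integrable states supplies such a sequence. -/
theorem isAmplitude_iff (hσ : MeasurableSet σ) (hg : Measurable g)
    (hUS : IsUnitaryGroupOf HS US) {φ : Kin σ K} {a : ℝ → K} :
    IsAmplitude σ g US τ φ a ↔ amplitudeL hσ hg hUS τ φ =ᵐ[volume] a := by
  have key : ∀ (ha : MemLp a 2 volume) (u : ℕ → Kin σ K),
      (∀ n, Integrable (u n) (volume.restrict σ)) →
      (Tendsto (fun n => eLpNorm (amplitude σ g US τ (u n) - a) 2 volume) atTop (𝓝 0) ↔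
      Tendsto (fun n => amplitudeL hσ hg hUS τ (u n)) atTop (𝓝 (ha.toLp a))) := by
    intro ha u hu
    rw [Lp.tendsto_Lp_iff_tendsto_eLpNorm']
    refine tendsto_congr fun n => eLpNorm_congr_ae ?_
    exact (amplitudeL_ae hσ hg hUS (hu n)).symm.sub ha.coeFn_toLp.symm
  constructor
  · rintro ⟨ha, u, hu, hu1, hu2⟩
    rw [key ha u fun n => (hu n).1] at hu2
    have h := tendsto_nhds_unique hu2 (((amplitudeL hσ hg hUS τ).continuous.tendsto φ).comp hu1)
    rw [← h]
    exact ha.coeFn_toLp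
  · intro h
    have ha : MemLp a 2 volume := (memLp_congr_ae h).1 (Lp.memLp _)
    obtain ⟨u, hu, hu1⟩ := mem_closure_iff_seq_limit.1 (dense_integrable φ)
    refine ⟨ha, u, fun n => ⟨hu n, ?_⟩, hu1, ?_⟩
    · exact (memLp_congr_ae (amplitudeL_ae hσ hg hUS (hu n))).1 (Lp.memLp _)
    · rw [key ha u hu]
      have e : ha.toLp a = amplitudeL hσ hg hUS τ φ :=
        Lp.ext (ha.coeFn_toLp.trans h.symm)
      rw [e]
      exact ((amplitudeL hσ hg hUS τ).continuous.tendsto φ).comp hu1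

end Amplitude

/-! ### Translations and pointwise relations on L²(ℝ; K). -/

section Translation

variable {K : Type*} [NormedAddCommGroup K] [InnerProductSpace ℂ K]

/-- Translation `a ↦ (t ↦ a (t + h))` on `L²(ℝ; K)`. -/
def translate (h : ℝ) : Lp K 2 (volume : Measure ℝ) →ₗᵢ[ℂ] Lp K 2 (volume : Measure ℝ) :=
  Lp.compMeasurePreservingₗᵢ ℂ (fun t => t + h) (measurePreserving_add_right volume h)

theorem translate_ae (h : ℝ) (a : Lp K 2 (volume : Measure ℝ)) :
    translate h a =ᵐ[volume] fun t => a (t + h) :=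
  Lp.coeFn_compMeasurePreserving a (measurePreserving_add_right volume h)

theorem ae_add_right {p : ℝ → Prop} (h : ∀ᵐ t, p t) (s : ℝ) : ∀ᵐ t, p (t + s) :=
  (measurePreserving_add_right volume s).quasiMeasurePreserving.ae h

theorem translate_translate (s t : ℝ) (a : Lp K 2 (volume : Measure ℝ)) :
    translate s (translate t a) = translate (s + t) a := by
  apply Lp.ext
  filter_upwards [translate_ae s (translate t a), translate_ae (s + t) a,
    ae_add_right (translate_ae t a) s] with x h1 h2 h3
  rw [h1, h2, h3, add_assoc]

theorem translate_zero (a : Lp K 2 (volume : Measure ℝ)) : translate 0 a = a := by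
  apply Lp.ext
  filter_upwards [translate_ae 0 a] with x h1
  rw [h1, add_zero]

theorem continuous_translate (a : Lp K 2 (volume : Measure ℝ)) :
    Continuous fun h => translate h a := by
  let g : C(ℝ, C(ℝ, ℝ)) := (ContinuousMap.mk (fun p : ℝ × ℝ => p.2 + p.1) (by fun_prop)).curry
  exact (continuous_const (y := a)).compMeasurePreservingLp g.continuous
    (fun h => measurePreserving_add_right volume h) (by norm_num)

theorem hasDerivAt_translate {a d : Lp K 2 (volume : Measure ℝ)}
    (h : HasDerivAt (fun t => translate t a) d 0) (s : ℝ) :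
    HasDerivAt (fun t => translate t a) (translate s d) s := by
  have h1 : HasDerivAt (fun t => translate (t - s) a) d s := by
    have h0 : HasDerivAt (fun t => translate t a) d (s - s) := by rwa [sub_self]
    exact h0.comp_sub_const s s
  have h2 := ((translate s).toContinuousLinearMap.restrictScalars ℝ).hasFDerivAt.comp_hasDerivAt
    s h1
  refine h2.congr_of_eventuallyEq (Eventually.of_forall fun t => ?_)
  simp [translate_translate]

/-- The pairs of square-integrable functions with values in a given relation. -/
def liftGraph (G : Submodule ℂ (K × K)) :
    Submodule ℂ (Lp K 2 (volume : Measure ℝ) × Lp K 2 (volume : Measure ℝ)) where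
  carrier := {p | ∀ᵐ t, (p.1 t, p.2 t) ∈ G}
  zero_mem' := by
    filter_upwards [Lp.coeFn_zero K 2 (volume : Measure ℝ)] with t h
    simp only [Prod.fst_zero, Prod.snd_zero, h]
    exact G.zero_mem
  add_mem' := by
    rintro ⟨a, b⟩ ⟨c, d⟩ h1 h2
    filter_upwards [h1, h2, Lp.coeFn_add a c, Lp.coeFn_add b d] with t h1 h2 h3 h4
    simp only [Prod.mk_add_mk, h3, h4]
    exact G.add_mem h1 h2
  smul_mem' := by
    rintro z ⟨a, b⟩ h1
    filter_upwards [h1, Lp.coeFn_smul z a, Lp.coeFn_smul z b] with t h1 h3 h4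
    simp only [Prod.smul_mk, h3, h4]
    exact G.smul_mem z h1

theorem mem_liftGraph {G : Submodule ℂ (K × K)} {a b : Lp K 2 (volume : Measure ℝ)} :
    (a, b) ∈ liftGraph G ↔ ∀ᵐ t, (a t, b t) ∈ G := Iff.rfl

/-- L² convergence gives almost everywhere convergence along a subsequence. Passing to one for each
coordinate in turn reduces the claim to closedness of `G` at almost every point. -/
theorem isClosed_liftGraph {G : Submodule ℂ (K × K)} (hG : IsClosed (G : Set (K × K))) :
    IsClosed (liftGraph G : Set (Lp K 2 (volume : Measure ℝ) × Lp K 2 (volume : Measure ℝ))) := by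
  refine IsSeqClosed.isClosed fun u p hu hup => ?_
  obtain ⟨m, hm, hm'⟩ := (tendstoInMeasure_of_tendsto_Lp
    ((continuous_fst.tendsto p).comp hup)).exists_seq_tendsto_ae
  obtain ⟨n, hn, hn'⟩ := (tendstoInMeasure_of_tendsto_Lp
    (((continuous_snd.tendsto p).comp hup).comp hm.tendsto_atTop)).exists_seq_tendsto_ae
  have hu' : ∀ᵐ t, ∀ k, ((u k).1 t, (u k).2 t) ∈ G := ae_all_iff.2 fun k => hu k
  show ∀ᵐ t, (p.1 t, p.2 t) ∈ G
  filter_upwards [hm', hn', hu'] with t h1 h2 h3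
  exact hG.mem_of_tendsto ((h1.comp hn.tendsto_atTop).prodMk_nhds h2)
    (Eventually.of_forall fun k => h3 (m (n k)))

theorem translate_mem_liftGraph {G : Submodule ℂ (K × K)} {a b : Lp K 2 (volume : Measure ℝ)}
    (h : (a, b) ∈ liftGraph G) (s : ℝ) : (translate s a, translate s b) ∈ liftGraph G := by
  rw [mem_liftGraph] at h ⊢
  filter_upwards [translate_ae s a, translate_ae s b, ae_add_right h s] with t h1 h2 h3
  rwa [h1, h2]

theorem liftGraph_functional {G : Submodule ℂ (K × K)} (hG : ∀ x ∈ G, x.1 = 0 → x.2 = 0)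
    {a b b' : Lp K 2 (volume : Measure ℝ)} (h : (a, b) ∈ liftGraph G)
    (h' : (a, b') ∈ liftGraph G) : b = b' := by
  apply Lp.ext
  filter_upwards [mem_liftGraph.1 h, mem_liftGraph.1 h'] with t h1 h2
  have h3 := hG _ (G.sub_mem h1 h2) (by simp)
  exact sub_eq_zero.1 h3

/-- A closed subspace is complete, so the integral can be formed inside it. -/
theorem intervalIntegral_mem_of_isClosed {E : Type*} [NormedAddCommGroup E] [NormedSpace ℂ E]
    [CompleteSpace E] {G : Submodule ℂ E} (hG : IsClosed (G : Set E)) {c : ℝ → E}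
    (hc : Continuous c) (hcG : ∀ t, c t ∈ G) (x y : ℝ) : ∫ t in x..y, c t ∈ G := by
  have : CompleteSpace G := hG.completeSpace_coe
  have hc' : Continuous fun t => (⟨c t, hcG t⟩ : G) := hc.subtype_mk _
  have h := G.subtypeL.intervalIntegral_comp_comm (hc'.intervalIntegrable (μ := volume) x y)
  have h' : ∫ t in x..y, c t = G.subtypeL (∫ t in x..y, (⟨c t, hcG t⟩ : G)) := h
  rw [h']
  exact Subtype.coe_prop _

/-- The coordinatewise integrals of two continuous curves lie in a closed subspace that contains
the pair of curves. -/
theorem intervalIntegral_pair_mem {E : Type*} [NormedAddCommGroup E] [NormedSpace ℂ E]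
    [CompleteSpace E] {G : Submodule ℂ (E × E)} (hG : IsClosed (G : Set (E × E))) {c d : ℝ → E}
    (hc : Continuous c) (hd : Continuous d) (h : ∀ t, (c t, d t) ∈ G) (x y : ℝ) :
    (∫ t in x..y, c t, ∫ t in x..y, d t) ∈ G := by
  have hi := (hc.prodMk hd).intervalIntegrable (μ := volume) x y
  have h3 : ∫ t in x..y, c t = (∫ t in x..y, (c t, d t)).1 :=
    (ContinuousLinearMap.fst ℂ E E).intervalIntegral_comp_comm hi
  have h4 : ∫ t in x..y, d t = (∫ t in x..y, (c t, d t)).2 :=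
    (ContinuousLinearMap.snd ℂ E E).intervalIntegral_comp_comm hi
  rw [h3, h4]
  exact intervalIntegral_mem_of_isClosed hG (hc.prodMk hd) h x y

/-- Closedness alone does not make the difference quotients of `d` converge. Integrating does: (c s
- c 0, ∫₀ˢ d') and (c s - c 0, d s - d 0) both lie in the graph, so single-valuedness exhibits `d`
as a primitive of the continuous `d'`. -/
theorem hasDerivAt_of_mem_closed_graph {E : Type*} [NormedAddCommGroup E] [NormedSpace ℂ E]
    [CompleteSpace E] {G : Submodule ℂ (E × E)} (hG : IsClosed (G : Set (E × E)))
    (hG0 : ∀ x y y', (x, y) ∈ G → (x, y') ∈ G → y = y') {c d c' d' : ℝ → E}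
    (hc : ∀ t, HasDerivAt c (c' t) t) (hc' : Continuous c') (hd' : Continuous d')
    (h : ∀ t, (c t, d t) ∈ G) (h' : ∀ t, (c' t, d' t) ∈ G) : HasDerivAt d (d' 0) 0 := by
  have key : ∀ s, d s = d 0 + ∫ t in (0 : ℝ)..s, d' t := by
    intro s
    have h1 : ∫ t in (0 : ℝ)..s, c' t = c s - c 0 :=
      intervalIntegral.integral_eq_sub_of_hasDerivAt (fun t _ => hc t)
        (hc'.intervalIntegrable _ _)
    have h2 := intervalIntegral_pair_mem hG hc' hd' h' 0 s
    rw [h1] at h2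
    rw [hG0 _ _ _ h2 (G.sub_mem (h s) (h 0))]
    abel
  have h7 := intervalIntegral.integral_hasDerivAt_right (hd'.intervalIntegrable 0 0)
    (hd'.stronglyMeasurableAtFilter volume (𝓝 0)) hd'.continuousAt
  exact (h7.const_add (d 0)).congr_of_eventuallyEq (Eventually.of_forall key)

variable [CompleteSpace K]

theorem hasDerivAt_translate_of_liftGraph {G : Submodule ℂ (K × K)}
    (hG : IsClosed (G : Set (K × K))) (hG0 : ∀ x ∈ G, x.1 = 0 → x.2 = 0)
    {a b a' b' : Lp K 2 (volume : Measure ℝ)} (h : (a, b) ∈ liftGraph G)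
    (h' : (a', b') ∈ liftGraph G) (hd : HasDerivAt (fun t => translate t a) a' 0) :
    HasDerivAt (fun t => translate t b) b' 0 := by
  have hG1 := isClosed_liftGraph hG
  have hG2 : ∀ x y y', (x, y) ∈ liftGraph G → (x, y') ∈ liftGraph G → y = y' :=
    fun _ _ _ => liftGraph_functional hG0
  have := hasDerivAt_of_mem_closed_graph (E := Lp K 2 (volume : Measure ℝ)) (G := liftGraph G)
    hG1 hG2 (hasDerivAt_translate hd) (continuous_translate a')
    (continuous_translate b') (translate_mem_liftGraph h) (translate_mem_liftGraph h')
  rwa [translate_zero] at this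

end Translation

/-! ### The unitary group of the constraint and its generator. -/

section ConstraintGroup

variable {K : Type*} [NormedAddCommGroup K] [InnerProductSpace ℂ K] [CompleteSpace K]
  {σ : Set ℝ} {g : ℝ → ℝ} {US : ℝ → K →L[ℂ] K} {HS : K →ₗ.[ℂ] K} {f : K →ₗ.[ℂ] K} {τ : ℝ}

theorem UCS_UCS (hUS : IsUnitaryGroupOf HS US) (s t : ℝ) (φ : Kin σ K) :
    UCS σ US s (UCS σ US t φ) = UCS σ US (s + t) φ := by
  apply Lp.ext
  filter_upwards [UCS_coe (US := US) s (UCS σ US t φ), UCS_coe (US := US) t φ,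
    UCS_coe (US := US) (s + t) φ] with ε h1 h2 h3
  rw [h1, h2, h3, hUS.add_apply, map_smul, smul_smul, ← Complex.exp_add]
  congr 2
  push_cast
  ring

theorem UCS_zero (hUS : IsUnitaryGroupOf HS US) (φ : Kin σ K) : UCS σ US 0 φ = φ := by
  apply Lp.ext
  filter_upwards [UCS_coe (US := US) 0 φ] with ε h
  simp [h, hUS.map_zero]

/-- `U_CS(t)` as a linear isometry. -/
def UCSL (σ : Set ℝ) (hUS : IsUnitaryGroupOf HS US) (t : ℝ) : Kin σ K →ₗᵢ[ℂ] Kin σ K where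
  toFun := UCS σ US t
  map_add' := UCS_add t
  map_smul' := UCS_smul t
  norm_map' φ := by
    show ‖UCS σ US t φ‖ = ‖φ‖
    rw [Lp.norm_def, Lp.norm_def]
    congr 1
    refine eLpNorm_congr_norm_ae ?_
    filter_upwards [UCS_coe (US := US) t φ] with ε h
    rw [h, norm_smul, Complex.norm_exp, hUS.norm_map]
    simp

theorem UCSL_apply (hUS : IsUnitaryGroupOf HS US) (t : ℝ) (φ : Kin σ K) :
    UCSL σ hUS t φ = UCS σ US t φ := rfl

theorem inner_UCS_left (hUS : IsUnitaryGroupOf HS US) (t : ℝ) (φ ψ : Kin σ K) :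
    inner ℂ (UCS σ US t φ) ψ = inner ℂ φ (UCS σ US (-t) ψ) := by
  rw [← (UCSL σ hUS t).inner_map_map φ, UCSL_apply, UCSL_apply, UCS_UCS hUS, add_neg_cancel,
    UCS_zero hUS]

/-- For integrable states this is U_CS(-t) U_CS(s) = U_CS(-(t-s)); density and continuity do the
rest. -/
theorem amplitudeL_UCS (hσ : MeasurableSet σ) (hg : Measurable g) (hUS : IsUnitaryGroupOf HS US)
    (s : ℝ) (φ : Kin σ K) :
    amplitudeL hσ hg hUS τ (UCS σ US s φ) = translate (-s) (amplitudeL hσ hg hUS τ φ) := by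
  refine (dense_integrable (K := K)).induction (P := fun φ : Kin σ K =>
    amplitudeL hσ hg hUS τ (UCSL σ hUS s φ) = translate (-s) (amplitudeL hσ hg hUS τ φ))
    (fun φ hφ => ?_) ?_ φ
  · apply Lp.ext
    filter_upwards [amplitudeL_ae hσ hg hUS (τ := τ) (integrable_UCS (US := US) s hφ),
      translate_ae (-s) (amplitudeL hσ hg hUS τ φ),
      ae_add_right (amplitudeL_ae hσ hg hUS (τ := τ) hφ) (-s)] with t h1 h2 h3
    rw [UCSL_apply, h1, h2, h3, amplitude, amplitude, UCS_UCS hUS]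
    congr 2
    ring
  · exact isClosed_eq ((amplitudeL hσ hg hUS τ).continuous.comp (UCSL σ hUS s).continuous)
      ((translate (-s)).continuous.comp (amplitudeL hσ hg hUS τ).continuous)

/-- `t ↦ exp (-i ε t) exp (-i t H_S)` is differentiable along vectors of the domain of `H_S`. -/
theorem hasDerivAt_phase_apply (hUS : IsUnitaryGroupOf HS US) (ε : ℝ) {x y : K}
    (h : (x, y - (ε : ℂ) • x) ∈ HS.graph) (t : ℝ) :
    HasDerivAt (fun t : ℝ => cexp (-(I * ε * t)) • US t x)
      (-(I • cexp (-(I * ε * t)) • US t y)) t := by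
  have h0 := (hUS.mem_graph_iff _ _).1 h
  have h1 : HasDerivAt (fun s => US (s - t) x) (-(I • (y - (ε : ℂ) • x))) t := by
    have h0' : HasDerivAt (fun s => US s x) (-(I • (y - (ε : ℂ) • x))) (t - t) := by
      rwa [sub_self]
    exact h0'.comp_sub_const t t
  have h2 := ((US t).restrictScalars ℝ).hasFDerivAt.comp_hasDerivAt t h1
  have h3 : HasDerivAt (fun s => US s x) (US t (-(I • (y - (ε : ℂ) • x)))) t := by
    refine h2.congr_of_eventuallyEq (Eventually.of_forall fun s => ?_)
    simp [← hUS.add_apply]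
  have h4 : HasDerivAt (fun t : ℝ => cexp (-(I * ε * t))) (cexp (-(I * ε * t)) * -(I * ε)) t := by
    have h5 : HasDerivAt (fun t : ℝ => -(I * ε * t)) (-(I * ε)) t := by
      have h6 : HasDerivAt (fun t : ℝ => (t : ℂ)) 1 t := (hasDerivAt_id (t : ℂ)).comp_ofReal
      have h7 := (h6.const_mul (I * ε)).fun_neg
      rwa [mul_one] at h7
    exact h5.cexp
  refine (h4.smul h3).congr_deriv ?_
  simp only [map_neg, map_smul, map_sub]
  module

/-- Mean value inequality: the derivative has norm ‖y‖ at every time. This bounds the difference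
quotients uniformly in t, as dominated convergence in ε requires. -/
theorem norm_phase_apply_sub_le (hUS : IsUnitaryGroupOf HS US) (ε : ℝ) {x y : K}
    (h : (x, y - (ε : ℂ) • x) ∈ HS.graph) (t : ℝ) :
    ‖cexp (-(I * ε * t)) • US t x - x‖ ≤ ‖y‖ * ‖t‖ := by
  have hb := Convex.norm_image_sub_le_of_norm_hasDerivWithin_le (C := ‖y‖) (s := Set.univ)
    (fun t _ => (hasDerivAt_phase_apply hUS ε h t).hasDerivWithinAt)
    (fun t _ => ?_) convex_univ (Set.mem_univ 0) (Set.mem_univ t)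
  · simpa [hUS.map_zero] using hb
  · simp [norm_smul, Complex.norm_exp, hUS.norm_map]

theorem slope_UCS_ae (hUS : IsUnitaryGroupOf HS US) (t : ℝ) (φ : Kin σ K) :
    ∀ᵐ ε ∂(volume.restrict σ), (t⁻¹ • (UCS σ US (0 + t) φ - UCS σ US 0 φ) : Kin σ K) ε =
      t⁻¹ • (cexp (-(I * ε * t)) • US t (φ ε) - φ ε) := by
  rw [zero_add, UCS_zero hUS]
  filter_upwards [Lp.coeFn_smul t⁻¹ (UCS σ US t φ - φ), Lp.coeFn_sub (UCS σ US t φ) φ,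
    UCS_coe (US := US) t φ] with ε h1 h2 h3
  simp only [h1, Pi.smul_apply, h2, Pi.sub_apply, h3]

theorem tendsto_eLpNorm_two_of_dominated {α E : Type*} [MeasurableSpace α] {μ : Measure α}
    [NormedAddCommGroup E] {D : ℕ → α → E} {B : α → ℝ} (hB : MemLp B 2 μ)
    (hD : ∀ n, AEStronglyMeasurable (D n) μ) (hDB : ∀ n, ∀ᵐ x ∂μ, ‖D n x‖ ≤ ‖B x‖)
    (h : ∀ᵐ x ∂μ, Tendsto (fun n => D n x) atTop (𝓝 0)) :
    Tendsto (fun n => eLpNorm (D n) 2 μ) atTop (𝓝 0) := by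
  simp only [eLpNorm_eq_lintegral_rpow_enorm_toReal two_ne_zero ENNReal.ofNat_ne_top]
  have h1 : Tendsto (fun n => ∫⁻ x, ‖D n x‖ₑ ^ (2 : ENNReal).toReal ∂μ) atTop
      (𝓝 (∫⁻ _, 0 ∂μ)) := by
    refine tendsto_lintegral_of_dominated_convergence' (fun x => ‖B x‖ₑ ^ (2 : ENNReal).toReal)
      (fun n => (hD n).enorm.pow_const _) (fun n => ?_)
      (lintegral_rpow_enorm_lt_top_of_eLpNorm_lt_top two_ne_zero ENNReal.ofNat_ne_top hB.2).ne ?_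
    · filter_upwards [hDB n] with x hx
      exact ENNReal.rpow_le_rpow (enorm_le_iff_norm_le.2 hx) ENNReal.toReal_nonneg
    · filter_upwards [h] with x hx
      have h2 := (ENNReal.continuous_rpow_const (y := (2 : ENNReal).toReal)).tendsto 0 |>.comp
        (by simpa using hx.enorm)
      simpa [Function.comp_def] using h2
  rw [lintegral_zero] at h1
  have h2 := ((ENNReal.continuous_rpow_const (y := 1 / (2 : ENNReal).toReal)).tendsto 0).comp h1
  simpa [Function.comp_def] using h2

theorem hasDerivAt_UCS (hUS : IsUnitaryGroupOf HS US) {φ χ : Kin σ K}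
    (h : (φ, χ) ∈ constraintGraph σ HS) :
    HasDerivAt (fun t => UCS σ US t φ) (-(I • χ)) 0 := by
  rw [hasDerivAt_iff_tendsto_slope_zero, Lp.tendsto_Lp_iff_tendsto_eLpNorm']
  have h : ∀ᵐ ε ∂(volume.restrict σ), (φ ε, χ ε - (ε : ℂ) • φ ε) ∈ HS.graph := h
  have hpt : ∀ t : ℝ, ∀ᵐ ε ∂(volume.restrict σ),
      ((t⁻¹ • (UCS σ US (0 + t) φ - UCS σ US 0 φ) : Kin σ K) - (-(I • χ) : Kin σ K) : ℝ → K) ε =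
        t⁻¹ • (cexp (-(I * ε * t)) • US t (φ ε) - φ ε) - -(I • χ ε) := by
    intro t
    filter_upwards [slope_UCS_ae hUS t φ, Lp.coeFn_neg (I • χ), Lp.coeFn_smul I χ]
      with ε h1 h4 h5
    simp only [Pi.sub_apply, h1, h4, Pi.neg_apply, h5, Pi.smul_apply]
  refine tendsto_of_seq_tendsto fun t ht => ?_
  refine tendsto_eLpNorm_two_of_dominated ((Lp.memLp χ).norm.const_mul (2 : ℝ))
    (fun n => (Lp.memLp _).1.sub (Lp.memLp _).1) ?_ ?_
  · intro n
    filter_upwards [hpt (t n), h] with ε h1 h2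
    rw [h1]
    have h3 := norm_phase_apply_sub_le hUS ε h2 (t n)
    have h4 : ‖(t n)⁻¹‖ * (‖χ ε‖ * ‖t n‖) ≤ ‖χ ε‖ := by
      -- The sequence avoids 0 only eventually; where it is 0, the convention 0⁻¹ = 0 makes the
      -- bound trivial.
      rcases eq_or_ne (t n) 0 with h0 | h0
      · simp [h0]
      · rw [norm_inv, mul_comm ‖χ ε‖, inv_mul_cancel_left₀ (norm_ne_zero_iff.2 h0)]
    calc _ ≤ ‖(t n)⁻¹ • (cexp (-(I * ε * t n)) • US (t n) (φ ε) - φ ε)‖ + ‖-(I • χ ε)‖ :=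
          norm_sub_le _ _
      _ ≤ ‖(t n)⁻¹‖ * (‖χ ε‖ * ‖t n‖) + ‖χ ε‖ := by
          rw [norm_smul, norm_neg, norm_smul, norm_I, one_mul]
          gcongr
      _ ≤ 2 * ‖χ ε‖ := by linarith
      _ = ‖2 * ‖χ ε‖‖ := by simp
  · filter_upwards [ae_all_iff.2 fun n => hpt (t n), h] with ε h1 h2
    simp only [h1]
    have h3 := (hasDerivAt_iff_tendsto_slope_zero.1 (hasDerivAt_phase_apply hUS ε h2 0)).comp ht
    have h4 := h3.sub_const (-(I • χ ε))
    simpa [hUS.map_zero, Function.comp_def] using h4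

/-- Convergence is known only along a sequence, so the derivative criterion for `HS` does not apply
to x directly. It applies to each z in the domain of `HS`; moving the group across the inner product
puts x in the domain of the adjoint, which is `HS`. -/
theorem mem_graph_of_tendsto_slope (hHS : IsSelfAdjoint HS) (hUS : IsUnitaryGroupOf HS US)
    {ε : ℝ} {x y : K} {t : ℕ → ℝ} (ht : Tendsto t atTop (𝓝[≠] 0))
    (h : Tendsto (fun n => (t n)⁻¹ • (cexp (-(I * ε * t n)) • US (t n) x - x)) atTop
      (𝓝 (-(I • y)))) : (x, y - (ε : ℂ) • x) ∈ HS.graph := by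
  have key : ∀ z : HS.domain, inner ℂ (y - (ε : ℂ) • x) (z : K) = inner ℂ x (HS z) := by
    intro z
    have hz : ((z : K), (HS z + (ε : ℂ) • (z : K)) - (ε : ℂ) • (z : K)) ∈ HS.graph := by
      rw [add_sub_cancel_right]
      exact HS.mem_graph z
    -- Taking the adjoint reverses time, so the quotients of z are needed along -t n.
    have ht' : Tendsto (fun n => -t n) atTop (𝓝[≠] 0) := by
      rw [tendsto_nhdsWithin_iff] at ht ⊢
      refine ⟨by simpa using ht.1.neg, ?_⟩
      filter_upwards [ht.2] with n hn
      simpa using hn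
    have h1 := (hasDerivAt_iff_tendsto_slope_zero.1 (hasDerivAt_phase_apply hUS ε hz 0)).comp ht'
    have h2 := (tendsto_const_nhds (x := x)).inner (𝕜 := ℂ) h1
    have h3 := h.inner (𝕜 := ℂ) (tendsto_const_nhds (x := (z : K)))
    have e : ∀ n, inner ℂ ((t n)⁻¹ • (cexp (-(I * ε * t n)) • US (t n) x - x)) (z : K) =
        -inner ℂ x ((-t n)⁻¹ • (cexp (-(I * ε * (-t n : ℝ))) • US (-t n) (z : K) - z)) := by
      intro n
      have hc : (starRingEnd ℂ) (cexp (-(I * ε * t n))) = cexp (-(I * ε * (-t n : ℝ))) := by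
        rw [← Complex.exp_conj]
        simp
      rw [← Complex.coe_smul, ← Complex.coe_smul, inner_smul_left, inner_smul_right,
        inner_sub_left, inner_sub_right, inner_smul_left, inner_smul_right, hc,
        hUS.inner_apply_left, conj_ofReal]
      push_cast
      rw [inv_neg]
      ring
    simp only [e] at h3
    have h4 : Tendsto (fun n => -inner ℂ x ((-t n)⁻¹ •
        (cexp (-(I * ε * (-t n : ℝ))) • US (-t n) (z : K) - z))) atTop
        (𝓝 (-inner ℂ x (-(I • (HS z + (ε : ℂ) • (z : K)))))) := by
      simpa [hUS.map_zero, Function.comp_def, inner_add_right, inner_neg_right, add_comm]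
        using h2.neg
    have h5 := tendsto_nhds_unique h3 h4
    simp only [inner_neg_left, inner_neg_right, inner_smul_left, inner_smul_right, conj_I,
      inner_add_right, neg_neg, neg_mul] at h5
    have h6 := mul_left_cancel₀ I_ne_zero h5
    rw [inner_sub_left, h6, inner_smul_left, conj_ofReal]
    ring
  have hx : x ∈ HS.adjoint.domain := HS.mem_adjoint_domain_of_exists x ⟨_, key⟩
  have hxy : HS.adjoint ⟨x, hx⟩ = y - (ε : ℂ) • x :=
    LinearPMap.adjoint_apply_eq hHS.dense_domain _ key
  have hg : (x, y - (ε : ℂ) • x) ∈ HS.adjoint.graph := hxy ▸ HS.adjoint.mem_graph ⟨x, hx⟩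
  rwa [LinearPMap.isSelfAdjoint_def.1 hHS] at hg

theorem mem_constraintGraph_of_hasDerivAt (hHS : IsSelfAdjoint HS) (hUS : IsUnitaryGroupOf HS US)
    {φ χ : Kin σ K} (h : HasDerivAt (fun t => UCS σ US t φ) (-(I • χ)) 0) :
    (φ, χ) ∈ constraintGraph σ HS := by
  have ht : Tendsto (fun n : ℕ => 1 / ((n : ℝ) + 1)) atTop (𝓝[≠] 0) := by
    rw [tendsto_nhdsWithin_iff]
    exact ⟨tendsto_one_div_add_atTop_nhds_zero_nat, Eventually.of_forall fun n =>
      Nat.one_div_pos_of_nat.ne'⟩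
  -- The L² limit becomes a pointwise one for almost every ε only along a subsequence of 1/(n+1).
  obtain ⟨m, hm, hm'⟩ := (tendstoInMeasure_of_tendsto_Lp
    ((hasDerivAt_iff_tendsto_slope_zero.1 h).comp ht)).exists_seq_tendsto_ae
  show ∀ᵐ ε ∂(volume.restrict σ), (φ ε, χ ε - (ε : ℂ) • φ ε) ∈ HS.graph
  filter_upwards [hm', ae_all_iff.2 fun n => slope_UCS_ae hUS (1 / ((m n : ℝ) + 1)) φ,
    Lp.coeFn_neg (I • χ), Lp.coeFn_smul I χ] with ε h1 h2 h3 h4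
  refine mem_graph_of_tendsto_slope hHS hUS (ht.comp hm.tendsto_atTop) ?_
  rw [h3, Pi.neg_apply, h4] at h1
  refine h1.congr fun n => ?_
  exact h2 n

end ConstraintGroup

/-! ### The twirl as (1/2π) A* f̂ A. -/

section Twirl

variable {K : Type*} [NormedAddCommGroup K] [InnerProductSpace ℂ K] [CompleteSpace K]
  {σ : Set ℝ} {g : ℝ → ℝ} {US : ℝ → K →L[ℂ] K} {HS : K →ₗ.[ℂ] K} {f : K →ₗ.[ℂ] K} {τ : ℝ}

/-- The weak integral is the L² inner product of Aψ with b, that is ⟨ψ, A*b⟩, and density of the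
integrable ψ determines η. -/
theorem isTwirl_iff (hσ : MeasurableSet σ) (hg : Measurable g) (hUS : IsUnitaryGroupOf HS US)
    {φ η : Kin σ K} :
    IsTwirl σ g US f τ φ η ↔ ∃ b, (amplitudeL hσ hg hUS τ φ, b) ∈ liftGraph f.graph ∧
      η = (1 / (2 * Real.pi) : ℂ) • (amplitudeL hσ hg hUS τ).adjoint b := by
  have key : ∀ (b : Lp K 2 (volume : Measure ℝ)) {ψ : Kin σ K},
      Integrable ψ (volume.restrict σ) →
      (fun t => inner ℂ (amplitudeL hσ hg hUS τ ψ t) (b t)) =ᵐ[volume]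
        fun t => inner ℂ (amplitude σ g US τ ψ t) (b t) := by
    intro b ψ hψ
    filter_upwards [amplitudeL_ae hσ hg hUS (τ := τ) hψ] with t h
    rw [h]
  constructor
  · rintro ⟨a, b, ha, hb, hab, h⟩
    rw [isAmplitude_iff hσ hg hUS] at ha
    refine ⟨hb.toLp b, ?_, ?_⟩
    · rw [mem_liftGraph]
      filter_upwards [ha, hb.coeFn_toLp, hab] with t h1 h2 h3
      rwa [h1, h2]
    · refine (dense_integrable (K := K)).eq_of_inner_right ℂ fun ψ hψ => ?_
      rw [(h ψ hψ).2, inner_smul_right, ContinuousLinearMap.adjoint_inner_right,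
        L2.inner_def (amplitudeL hσ hg hUS τ ψ), integral_congr_ae (key _ hψ)]
      congr 1
      refine integral_congr_ae ?_
      filter_upwards [hb.coeFn_toLp] with t h2
      rw [h2]
  · rintro ⟨b, hb, rfl⟩
    refine ⟨amplitudeL hσ hg hUS τ φ, b, (isAmplitude_iff hσ hg hUS).2 ae_eq_rfl, Lp.memLp b,
      hb, fun ψ hψ => ⟨(L2.integrable_inner _ _).congr (key b hψ), ?_⟩⟩
    rw [inner_smul_right, ContinuousLinearMap.adjoint_inner_right,
      L2.inner_def (amplitudeL hσ hg hUS τ ψ), integral_congr_ae (key b hψ)]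

theorem adjoint_amplitudeL_translate (hσ : MeasurableSet σ) (hg : Measurable g)
    (hUS : IsUnitaryGroupOf HS US) (s : ℝ) (b : Lp K 2 (volume : Measure ℝ)) :
    (amplitudeL hσ hg hUS τ).adjoint (translate (-s) b) =
      UCS σ US s ((amplitudeL hσ hg hUS τ).adjoint b) := by
  refine ext_inner_left ℂ fun ψ => ?_
  have h := inner_UCS_left hUS (-s) ψ ((amplitudeL hσ hg hUS τ).adjoint b)
  rw [neg_neg] at h
  rw [← h, ContinuousLinearMap.adjoint_inner_right, ContinuousLinearMap.adjoint_inner_right,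
    amplitudeL_UCS, neg_neg, ← (translate s).inner_map_map, translate_translate, add_neg_cancel,
    translate_zero]

theorem gTwirl_graph (hσ : MeasurableSet σ) (hg : Measurable g) (hUS : IsUnitaryGroupOf HS US) :
    (gTwirl σ hg US f τ).graph = gTwirlGraph σ hg US f τ := by
  refine Submodule.toLinearPMap_graph_eq _ ?_
  rintro ⟨φ, η⟩ h h0
  simp only at h0
  subst h0
  obtain ⟨b, hb, rfl⟩ := (isTwirl_iff hσ hg hUS).1 h
  have hb0 : b = 0 := by
    rw [map_zero] at hb
    exact liftGraph_functional (fun x hx h => f.graph_fst_eq_zero_snd hx h) hb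
      (liftGraph f.graph).zero_mem
  simp [hb0]

theorem mem_gTwirl_graph_iff (hσ : MeasurableSet σ) (hg : Measurable g)
    (hUS : IsUnitaryGroupOf HS US) {φ η : Kin σ K} :
    (φ, η) ∈ (gTwirl σ hg US f τ).graph ↔ IsTwirl σ g US f τ φ η := by
  rw [gTwirl_graph hσ hg hUS]
  rfl

/-- An everywhere defined closable operator equals its closure, hence is bounded by the closed graph
theorem, and a bounded operator acts pointwise on L². -/
theorem exists_isTwirl (hσ : MeasurableSet σ) (hg : Measurable g) (hUS : IsUnitaryGroupOf HS US)
    (hf : f.IsClosable) (hdom : f.domain = ⊤) (φ : Kin σ K) :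
    ∃ η, IsTwirl σ g US f τ φ η := by
  have hcl : f = f.closure := by
    refine LinearPMap.eq_of_le_of_domain_eq f.le_closure ?_
    rw [hdom, eq_comm, eq_top_iff, ← hdom]
    exact f.le_closure.1
  have hclosed : IsClosed (f.graph : Set (K × K)) := by
    rw [hcl]
    exact hf.closure_isClosed
  let f' : K →ₗ[ℂ] K := f.toFun ∘ₗ LinearMap.codRestrict f.domain LinearMap.id
    (fun x => hdom ▸ Submodule.mem_top)
  have hgr : ∀ x, (x, f' x) ∈ f.graph := fun x =>
    f.mem_graph ⟨x, hdom ▸ Submodule.mem_top⟩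
  have hgraph : (f'.graph : Set (K × K)) = f.graph := by
    ext ⟨x, y⟩
    simp only [SetLike.mem_coe, LinearMap.mem_graph_iff]
    refine ⟨fun h => ?_, fun h => ?_⟩
    · rw [h]
      exact hgr x
    · exact f.mem_graph_snd_inj h (hgr x) rfl
  have hcont : Continuous f' := f'.continuous_of_isClosed_graph (hgraph ▸ hclosed)
  let F : K →L[ℂ] K := ⟨f', hcont⟩
  refine ⟨_, (isTwirl_iff hσ hg hUS).2 ⟨F.compLp (amplitudeL hσ hg hUS τ φ), ?_, rfl⟩⟩
  rw [mem_liftGraph]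
  filter_upwards [F.coeFn_compLp (amplitudeL hσ hg hUS τ φ)] with t h
  rw [h]
  exact hgr _

theorem IsTwirl.map_UCS (hσ : MeasurableSet σ) (hg : Measurable g) (hUS : IsUnitaryGroupOf HS US)
    {φ η : Kin σ K} (h : IsTwirl σ g US f τ φ η) (s : ℝ) :
    IsTwirl σ g US f τ (UCS σ US s φ) (UCS σ US s η) := by
  obtain ⟨b, hb, rfl⟩ := (isTwirl_iff hσ hg hUS).1 h
  refine (isTwirl_iff hσ hg hUS).2 ⟨translate (-s) b, ?_, ?_⟩
  · rw [amplitudeL_UCS]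
    exact translate_mem_liftGraph hb (-s)
  · rw [adjoint_amplitudeL_translate, UCS_smul]

theorem IsTwirl.hasDerivAt_UCS (hσ : MeasurableSet σ) (hg : Measurable g)
    (hUS : IsUnitaryGroupOf HS US) (hf : f.IsClosable) {φ χ η ζ : Kin σ K}
    (h : IsTwirl σ g US f τ φ η) (h' : IsTwirl σ g US f τ χ ζ)
    (hd : HasDerivAt (fun t => UCS σ US t φ) (-(I • χ)) 0) :
    HasDerivAt (fun t => UCS σ US t η) (-(I • ζ)) 0 := by
  obtain ⟨b, hb, rfl⟩ := (isTwirl_iff hσ hg hUS).1 h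
  obtain ⟨b', hb', rfl⟩ := (isTwirl_iff hσ hg hUS).1 h'
  -- The differentiation argument needs a closed graph, so `f` is replaced by its closure; `b` and
  -- `b'` stay the same.
  have hle : ∀ p, p ∈ liftGraph f.graph → p ∈ liftGraph f.closure.graph := by
    intro p hp
    show ∀ᵐ t, (p.1 t, p.2 t) ∈ f.closure.graph
    filter_upwards [mem_liftGraph.1 hp] with t ht
    exact LinearPMap.le_graph_of_le f.le_closure ht
  -- Time is reversed twice because U_CS(t) corresponds to translation by -t: once on applying A,
  -- once on returning with A*.
  have neg_comp : ∀ {E : Type _} [NormedAddCommGroup E] [NormedSpace ℝ E] {u : ℝ → E} {v : E},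
      HasDerivAt u v 0 → HasDerivAt (fun t => u (-t)) (-v) 0 := by
    intro E _ _ u v h
    have h0 : HasDerivAt u v (-0) := by rwa [neg_zero]
    simpa [Function.comp_def] using h0.scomp (0 : ℝ) (hasDerivAt_neg (0 : ℝ))
  have h1 : HasDerivAt (fun t => translate t (amplitudeL hσ hg hUS τ φ))
      (I • amplitudeL hσ hg hUS τ χ) 0 := by
    have h2 := ((amplitudeL hσ hg hUS τ).restrictScalars ℝ).hasFDerivAt.comp_hasDerivAt (0 : ℝ)
      (neg_comp hd)
    refine (h2.congr_of_eventuallyEq (Eventually.of_forall fun t => ?_)).congr_deriv ?_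
    · simp [amplitudeL_UCS]
    · simp
  have h3 := hasDerivAt_translate_of_liftGraph (b' := I • b') hf.closure_isClosed
    (fun x hx h => f.closure.graph_fst_eq_zero_snd hx h) (hle _ hb)
    (by simpa using (liftGraph f.closure.graph).smul_mem I (hle _ hb')) h1
  have h4 := (((1 / (2 * Real.pi) : ℂ) • (amplitudeL hσ hg hUS τ).adjoint).restrictScalars
    ℝ).hasFDerivAt.comp_hasDerivAt (0 : ℝ) (neg_comp h3)
  refine (h4.congr_of_eventuallyEq (Eventually.of_forall fun t => ?_)).congr_deriv ?_
  · simp [adjoint_amplitudeL_translate, UCS_smul]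
  · simp [smul_comm I]

end Twirl

end RelationalDirac

/-! ### The commutation theorem. -/

theorem theorem1 {HilS : Type*} [NormedAddCommGroup HilS] [InnerProductSpace ℂ HilS]
    [CompleteSpace HilS]
    -- the clock: spectrum of the clock Hamiltonian and phases of the clock states
    (σ : Set ℝ) (hσ : MeasurableSet σ) (g : ℝ → ℝ) (hg : Measurable g)
    -- the system: self-adjoint Hamiltonian and the unitary group it generates
    (HS : HilS →ₗ.[ℂ] HilS) (hHS : IsSelfAdjoint HS)
    (US : ℝ → HilS →L[ℂ] HilS) (hUS : RelationalDirac.IsUnitaryGroupOf HS US)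
    -- the system observable and the clock reading
    (f : HilS →ₗ.[ℂ] HilS) (hf : f.IsClosable) (τ : ℝ) :
    let C := RelationalDirac.constraint σ HS
    let F := RelationalDirac.gTwirl σ hg US f τ
    -- the weak integral defines an operator `F`, everywhere if `f` is everywhere defined
    (∀ φ η, (φ, η) ∈ F.graph ↔ RelationalDirac.IsTwirl σ g US f τ φ η) ∧
    (f.domain = ⊤ → F.domain = ⊤) ∧
    -- `F` commutes with the unitary group generated by the constraint
    (∀ (s : ℝ) (φ : F.domain), ∃ h : RelationalDirac.UCS σ US s φ ∈ F.domain,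
      F ⟨RelationalDirac.UCS σ US s φ, h⟩ = RelationalDirac.UCS σ US s (F φ)) ∧
    -- `[C, F] = 0`
    (∀ (φ : RelationalDirac.Kin σ HilS) (hC : φ ∈ C.domain) (hF : φ ∈ F.domain)
      (hFC : C ⟨φ, hC⟩ ∈ F.domain),
      ∃ hCF : F ⟨φ, hF⟩ ∈ C.domain, C ⟨F ⟨φ, hF⟩, hCF⟩ = F ⟨C ⟨φ, hC⟩, hFC⟩) := by
  intro C F
  have mem {φ η} : (φ, η) ∈ F.graph ↔ RelationalDirac.IsTwirl σ g US f τ φ η :=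
    RelationalDirac.mem_gTwirl_graph_iff hσ hg hUS
  have eq_of_graph {φ η} (h : (φ, η) ∈ F.graph) : ∃ hφ : φ ∈ F.domain, F ⟨φ, hφ⟩ = η := by
    obtain ⟨x, hx, hxη⟩ := F.mem_graph_iff.1 h
    obtain rfl : (x : RelationalDirac.Kin σ HilS) = φ := hx
    exact ⟨x.2, hxη⟩
  refine ⟨fun φ η => mem, fun hdom => ?_, fun s φ => ?_, fun φ hC hF hFC => ?_⟩
  · refine eq_top_iff.2 fun φ _ => ?_
    obtain ⟨η, hη⟩ := RelationalDirac.exists_isTwirl (τ := τ) hσ hg hUS hf hdom φ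
    exact (eq_of_graph (mem.2 hη)).1
  · exact eq_of_graph (mem.2 ((mem.1 (F.mem_graph φ)).map_UCS hσ hg hUS s))
  · have hCgr : (φ, C ⟨φ, hC⟩) ∈ RelationalDirac.constraintGraph σ HS := by
      rw [← RelationalDirac.constraint_graph]
      exact C.mem_graph ⟨φ, hC⟩
    have hd := (mem.1 (F.mem_graph ⟨φ, hF⟩)).hasDerivAt_UCS hσ hg hUS hf
      (mem.1 (F.mem_graph ⟨_, hFC⟩)) (RelationalDirac.hasDerivAt_UCS hUS hCgr)
    have hgr := RelationalDirac.mem_constraintGraph_of_hasDerivAt hHS hUS hd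
    rw [← RelationalDirac.constraint_graph] at hgr
    obtain ⟨x, hx, hxη⟩ := C.mem_graph_iff.1 hgr
    have hx' : F ⟨φ, hF⟩ ∈ C.domain := by
      have h := x.2
      rwa [hx] at h
    refine ⟨hx', ?_⟩
    have e : (⟨F ⟨φ, hF⟩, hx'⟩ : C.domain) = x := Subtype.ext hx.symm
    rw [e]
    exact hxη
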